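/- All spaces and topological groups are Hausdorff. A *Parovičenko space* is a compact zero-dimensional $F$-space of weight $\mathfrak c$ in which every nonempty $G_\delta$-set has infinite interior, where an $F$-space is a space in which every cozero-set is $C^*$-embedded. For a compact space $X$, let $\mathcal H(X)$ be the group of homeomorphisms of $X$ with the compact-open topology. For a topological group $G$, let $G_{(\delta)}$ be the group $G$ with the topology that has the $G_\delta$-subsets of $G$ as a base. **Theorem 1.1.** Let $G$ be a topological group of weight $\mathfrak c$. Then there is a Parovičenko space $X$ such that $G_{(\delta)}$ is topologically isomorphic to a subgroup of $\mathcal H(X)$. Moreover, one can take $X=(\omega\times K)^*=\beta(\omega\times K)\setminus(\omega\times K)$ for some compact zero-dimensional space $K$, where $\omega$ is discrete, in such a way that $G_{(\delta)}$ is topologically isomorphic to a subgroup $H$ of $\mathcal H(K)$ and the homomorphism $f\mapsto \beta(\mathrm{id}_\omega\times f){\restriction}X$ from $\mathcal H(K)$ to $\mathcal H(X)$ restricts to a topological isomorphism of $H$ onto a subgroup of $\mathcal H(X)$. -/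

import Mathlib

universe u

open Cardinal Topology TopologicalSpace
open scoped BoundedContinuousFunction

/-! ## Topological notions -/

/-- The weight of a space: the least cardinality of a base. -/
noncomputable def topWeight (X : Type*) [TopologicalSpace X] : Cardinal :=
  ⨅ B : {B : Set (Set X) // IsTopologicalBasis B}, #B.1

/-- A space is zero-dimensional if its clopen sets form a base. -/
def IsZeroDimensional (X : Type*) [TopologicalSpace X] : Prop :=
  IsTopologicalBasis {s : Set X | IsClopen s}

/-- A cozero-set is the set where some continuous real-valued function does not vanish. -/
def IsCozeroSet {X : Type*} [TopologicalSpace X] (s : Set X) : Prop :=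
  ∃ f : C(X, ℝ), s = {x | f x ≠ 0}

/-- A subspace is `C*`-embedded if each bounded continuous real-valued function on it extends
to a bounded continuous function on the whole space. -/
def IsCStarEmbedded {X : Type*} [TopologicalSpace X] (s : Set X) : Prop :=
  ∀ g : s →ᵇ ℝ, ∃ h : X →ᵇ ℝ, ∀ x : s, h x = g x

/-- An `F`-space is a space in which cozero-sets are `C*`-embedded. -/
def IsFSpace (X : Type*) [TopologicalSpace X] : Prop :=
  ∀ s : Set X, IsCozeroSet s → IsCStarEmbedded s

/-- A Parovičenko space: a compact (Hausdorff) zero-dimensional `F`-space of weight `𝔠` in which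
each nonempty `Gδ`-set has infinite interior. -/
structure IsParovicenko (X : Type*) [TopologicalSpace X] : Prop where
  compact : CompactSpace X
  t2 : T2Space X
  zeroDimensional : IsZeroDimensional X
  fSpace : IsFSpace X
  weight : topWeight X = 𝔠
  infinite_interior : ∀ s : Set X, IsGδ s → s.Nonempty → (interior s).Infinite

/-! ## The `Gδ`-modification -/

/-- The set `X`, to be equipped with the `Gδ`-modification of the topology of `X`. -/
def GDeltaMod (X : Type*) : Type _ := X

instance (X : Type*) [Group X] : Group (GDeltaMod X) := inferInstanceAs (Group X)

/-- The topology generated by the `Gδ`-subsets of `X` (which form a base of it). -/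
instance (X : Type*) [TopologicalSpace X] : TopologicalSpace (GDeltaMod X) :=
  generateFrom {s : Set X | IsGδ s}

/-! ## Homeomorphism groups -/

/-- The compact-open topology on the group of homeomorphisms of `X`: the subspace topology
inherited from the space `C(X, X)` with the compact-open topology. -/
instance homeomorphCompactOpen (X : Type*) [TopologicalSpace X] : TopologicalSpace (X ≃ₜ X) :=
  TopologicalSpace.induced (fun f => (f : C(X, X))) ContinuousMap.compactOpen

/-! ## Čech–Stone remainders -/

section Remainder

/-- The Čech–Stone remainder `X* = βX \ X`. -/
abbrev CechStoneRemainder (X : Type*) [TopologicalSpace X] : Type _ :=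
  {p : StoneCech X // p ∉ Set.range (stoneCechUnit : X → StoneCech X)}

variable {Z : Type*} [TopologicalSpace Z]

/-- The Stone extension `βf : βZ → βZ` of a homeomorphism `f` of `Z`, as a function. -/
noncomputable def stoneExtension (f : Z ≃ₜ Z) : StoneCech Z → StoneCech Z :=
  stoneCechExtend (continuous_stoneCechUnit.comp f.continuous)

theorem continuous_stoneExtension (f : Z ≃ₜ Z) : Continuous (stoneExtension f) :=
  continuous_stoneCechExtend _

theorem stoneExtension_unit (f : Z ≃ₜ Z) (z : Z) :
    stoneExtension f (stoneCechUnit z) = stoneCechUnit (f z) :=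
  congrFun (stoneCechExtend_extends (continuous_stoneCechUnit.comp f.continuous)) z

theorem stoneExtension_mul (f g : Z ≃ₜ Z) (p : StoneCech Z) :
    stoneExtension (f * g) p = stoneExtension f (stoneExtension g p) := by
  refine congrFun (stoneCech_hom_ext (continuous_stoneExtension _)
    ((continuous_stoneExtension f).comp (continuous_stoneExtension g)) ?_) p
  funext z
  simp [stoneExtension_unit]

theorem stoneExtension_one (p : StoneCech Z) : stoneExtension (1 : Z ≃ₜ Z) p = p := by
  refine congrFun (stoneCech_hom_ext (g₂ := id) (continuous_stoneExtension _) continuous_id ?_) p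
  funext z
  simp [stoneExtension_unit]

/-- The homeomorphism `βf` of `βZ` induced by a homeomorphism `f` of `Z`. -/
noncomputable def stoneHomeomorph (f : Z ≃ₜ Z) : StoneCech Z ≃ₜ StoneCech Z where
  toFun := stoneExtension f
  invFun := stoneExtension f⁻¹
  left_inv p := by rw [← stoneExtension_mul, inv_mul_cancel, stoneExtension_one]
  right_inv p := by rw [← stoneExtension_mul, mul_inv_cancel, stoneExtension_one]
  continuous_toFun := continuous_stoneExtension f
  continuous_invFun := continuous_stoneExtension f⁻¹

theorem stoneHomeomorph_mem_range (f : Z ≃ₜ Z) (p : StoneCech Z) :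
    p ∉ Set.range (stoneCechUnit : Z → StoneCech Z) ↔
      stoneHomeomorph f p ∉ Set.range (stoneCechUnit : Z → StoneCech Z) := by
  refine not_congr ⟨?_, ?_⟩
  · rintro ⟨z, rfl⟩
    exact ⟨f z, (stoneExtension_unit f z).symm⟩
  · rintro ⟨z, hz⟩
    refine ⟨f⁻¹ z, ?_⟩
    rw [← stoneExtension_unit, hz]
    exact (stoneHomeomorph f).symm_apply_apply p

/-- The homomorphism `f ↦ βf ↾ Z*` from homeomorphisms of `Z` to homeomorphisms of `Z*`. -/
noncomputable def remainderHom (Z : Type*) [TopologicalSpace Z] :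
    (Z ≃ₜ Z) →* (CechStoneRemainder Z ≃ₜ CechStoneRemainder Z) where
  toFun f := (stoneHomeomorph f).subtype (stoneHomeomorph_mem_range f)
  map_one' := by
    ext p
    exact stoneExtension_one p.1
  map_mul' f g := by
    ext p
    exact stoneExtension_mul f g p.1

/-- The homomorphism `f ↦ id × f` from homeomorphisms of `K` to homeomorphisms of `ω × K`. -/
def omegaProdHom (K : Type*) [TopologicalSpace K] : (K ≃ₜ K) →* ((ℕ × K) ≃ₜ (ℕ × K)) where
  toFun f := (Homeomorph.refl ℕ).prodCongr f
  map_one' := rfl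
  map_mul' _ _ := rfl

/-- The homomorphism `f ↦ β(id × f) ↾ (ω × K)*`. -/
noncomputable def omegaRemainderHom (K : Type*) [TopologicalSpace K] :
    (K ≃ₜ K) →* (CechStoneRemainder (ℕ × K) ≃ₜ CechStoneRemainder (ℕ × K)) :=
  (remainderHom (ℕ × K)).comp (omegaProdHom K)

end Remainder

open Set Filter

/-! ## Zero-dimensional compact spaces and their homeomorphism groups -/

/-! In `GDeltaMod G` countable intersections of neighbourhoods are neighbourhoods, and the
`Gδ`-subgroups `N` form a neighbourhood base at 1. A suitable family of at most `𝔠` of them, each of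
index at most `𝔠`, suffices. Let `G` permute the disjoint union `D` of the coset spaces `G ⧸ N`: the
`Gδ`-topology is then pointwise convergence on discrete `D` (`exists_mulAction_isGδ`).

Put `K = OnePoint D`. For compact zero-dimensional spaces the compact-open topology only records
preimages of clopen sets (`nhds_homeomorph_eq`). Clopen subsets of `K` are finite subsets of `D` or
complements of such, so `G` with the `Gδ`-topology embeds in the homeomorphism group of `K`
(`isInducing_onePointHom`).

A clopen subset of `(ω × K)*` is a sequence of clopen subsets of `K` modulo finitely many terms
(`remainder_preimage_subset_iff`). Fixing its preimage is implied by countably many conditions on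
`K`, which the `Gδ`-topology absorbs; constant sequences recover the conditions on `K`
(`isInducing_omegaRemainderHom_comp`).

The same description makes the remainder Parovičenko: there are at most `𝔠 ^ ℵ₀ = 𝔠` such sequences,
an almost disjoint family bounds the weight below, and gluing along the levels of `ω` gives the
`F`-space and `Gδ` properties. -/

theorem IsZeroDimensional.totallyDisconnectedSpace {X : Type*} [TopologicalSpace X] [T2Space X]
    (h : IsZeroDimensional X) : TotallyDisconnectedSpace X := by
  suffices TotallySeparatedSpace X from inferInstance
  refine totallySeparatedSpace_iff_exists_isClopen.2 fun x y hxy => ?_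
  obtain ⟨V, hV, hxV, hVy⟩ := h.exists_subset_of_mem_open (show x ∈ ({y} : Set X)ᶜ from hxy)
    isOpen_compl_singleton
  exact ⟨V, hV, hxV, fun hy => hVy hy rfl⟩

theorem isZeroDimensional_of_totallyDisconnectedSpace (X : Type*) [TopologicalSpace X]
    [CompactSpace X] [T2Space X] [TotallyDisconnectedSpace X] : IsZeroDimensional X :=
  isTopologicalBasis_isClopen

/-- If `f` maps a compact `C` into an open `O`, a clopen `V` fits between `f '' C` and `O`.
Conversely, equality of preimages of `V` amounts to two subbasic conditions, one for `V` and one for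
`Vᶜ`. -/
theorem nhds_homeomorph_eq {K : Type*} [TopologicalSpace K] [CompactSpace K] [T2Space K]
    [TotallyDisconnectedSpace K] (f : K ≃ₜ K) :
    𝓝 f = ⨅ V : {V : Set K // IsClopen V}, 𝓟 {g : K ≃ₜ K | g ⁻¹' V.1 = f ⁻¹' V.1} := by
  rw [nhds_induced]
  apply le_antisymm
  · rw [le_iInf_iff]
    rintro ⟨V, hV⟩
    rw [le_principal_iff]
    have h1 : {g : C(K, K) | MapsTo g (f ⁻¹' V) V} ∈ 𝓝 (f : C(K, K)) :=
      (ContinuousMap.isOpen_setOfPred_mapsTo (hV.1.preimage f.continuous).isCompact hV.2).mem_nhds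
        fun x hx => hx
    have h2 : {g : C(K, K) | MapsTo g (f ⁻¹' Vᶜ) Vᶜ} ∈ 𝓝 (f : C(K, K)) :=
      (ContinuousMap.isOpen_setOfPred_mapsTo (hV.compl.1.preimage f.continuous).isCompact
        hV.compl.2).mem_nhds fun x hx => hx
    filter_upwards [preimage_mem_comap h1, preimage_mem_comap h2] with g hg1 hg2
    ext x
    exact ⟨fun hx => by_contra fun hx' => hg2 hx' hx, fun hx => hg1 hx⟩
  · rw [ContinuousMap.nhds_compactOpen, comap_iInf, le_iInf_iff]
    intro C
    rw [comap_iInf, le_iInf_iff]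
    intro hC
    rw [comap_iInf, le_iInf_iff]
    intro O
    rw [comap_iInf, le_iInf_iff]
    intro hO
    rw [comap_iInf, le_iInf_iff]
    intro hCO
    obtain ⟨V, hV, hCV, hVO⟩ := exists_clopen_of_closed_subset_open
      (hC.image f.continuous).isClosed hO (mapsTo_iff_image_subset.1 hCO)
    refine (iInf_le _ ⟨V, hV⟩).trans ?_
    rw [comap_principal, principal_mono]
    intro g (hg : g ⁻¹' V = f ⁻¹' V) x hx
    refine hVO (?_ : x ∈ g ⁻¹' V)
    rw [hg]
    exact hCV (mem_image_of_mem f hx)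

/-! ## The `Gδ`-modification -/

section GDeltaMod

variable {G : Type*} [TopologicalSpace G]

theorem isTopologicalBasis_gDeltaMod :
    IsTopologicalBasis (α := GDeltaMod G) {s : Set G | IsGδ s} := by
  refine ⟨fun s hs t ht x hx => ⟨s ∩ t, IsGδ.inter hs ht, hx, subset_rfl⟩, ?_, rfl⟩
  exact sUnion_eq_univ_iff.2 fun x => ⟨univ, IsGδ.univ, mem_univ _⟩

theorem mem_nhds_gDeltaMod_iff {x : GDeltaMod G} {s : Set (GDeltaMod G)} :
    s ∈ 𝓝 x ↔ ∃ t : Set G, IsGδ t ∧ x ∈ t ∧ t ⊆ s :=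
  isTopologicalBasis_gDeltaMod.mem_nhds_iff

theorem iInter_mem_nhds_gDeltaMod {x : GDeltaMod G} {s : ℕ → Set (GDeltaMod G)}
    (hs : ∀ n, s n ∈ 𝓝 x) : ⋂ n, s n ∈ 𝓝 x := by
  simp only [mem_nhds_gDeltaMod_iff] at hs ⊢
  choose t ht hx hts using hs
  exact ⟨⋂ n, t n, .iInter ht, mem_iInter.2 hx, iInter_mono hts⟩

instance [T2Space G] : T2Space (GDeltaMod G) := by
  refine T2Space.of_injective_continuous (f := fun x : GDeltaMod G => (show G from x))
    (fun _ _ h => h) ?_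
  exact continuous_def.2 fun s hs => isOpen_generateFrom_of_mem hs.isGδ

end GDeltaMod

/-- Choose open `V (n + 1) ⊆ U n` whose inverses and pairwise products lie in `V n`; the
intersection of all `V n` is then a subgroup. -/
theorem exists_isGδ_subgroup {G : Type*} [Group G] [TopologicalSpace G] [IsTopologicalGroup G]
    (U : ℕ → Set G) (hU : ∀ n, U n ∈ 𝓝 1) :
    ∃ N : Subgroup G, IsGδ (N : Set G) ∧ ∀ n, (N : Set G) ⊆ U n := by
  have step : ∀ W : {W : Set G // IsOpen W ∧ 1 ∈ W}, ∀ n, ∃ V : {W : Set G // IsOpen W ∧ 1 ∈ W},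
      V.1 ⊆ U n ∧ (∀ x ∈ V.1, x⁻¹ ∈ W.1) ∧ ∀ x ∈ V.1, ∀ y ∈ V.1, x * y ∈ W.1 := by
    rintro ⟨W, hW, h1W⟩ n
    obtain ⟨V, hV, h1V, hVW⟩ := exists_open_nhds_one_split (hW.mem_nhds h1W)
    refine ⟨⟨V ∩ V⁻¹ ∩ interior (U n), (hV.inter hV.inv).inter isOpen_interior,
      ⟨h1V, by simpa using h1V⟩, mem_interior_iff_mem_nhds.2 (hU n)⟩,
      fun x hx => interior_subset hx.2, fun x hx => ?_, fun x hx y hy => hVW _ hx.1.1 _ hy.1.1⟩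
    simpa using hVW _ (mem_inv.1 hx.1.2) 1 h1V
  choose F hF hinv hmul using step
  let V : ℕ → {W : Set G // IsOpen W ∧ 1 ∈ W} :=
    fun n => Nat.rec ⟨univ, isOpen_univ, mem_univ _⟩ (fun n W => F W n) n
  have hV (n) : V (n + 1) = F (V n) n := rfl
  refine ⟨{ carrier := ⋂ n, (V n).1, mul_mem' := ?_, one_mem' := ?_, inv_mem' := ?_ },
    .iInter fun n => (V n).2.1.isGδ, fun n x hx => hF (V n) n ?_⟩
  · intro x y hx hy
    rw [mem_iInter] at *
    exact fun n => hmul (V n) n x (hV n ▸ hx (n + 1)) y (hV n ▸ hy (n + 1))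
  · exact mem_iInter.2 fun n => (V n).2.2
  · intro x hx
    rw [mem_iInter] at *
    exact fun n => hinv (V n) n x (hV n ▸ hx (n + 1))
  · exact mem_iInter.1 hx (n + 1)

/-! ## Permutations acting on one-point compactifications of discrete spaces -/

section OnePoint

variable {D : Type*} [TopologicalSpace D] [DiscreteTopology D]

theorem OnePoint.isClopen_of_infty_mem_of_isOpen {s : Set (OnePoint D)} (h : OnePoint.infty ∈ s)
    (hs : IsOpen s) : IsClopen s := by
  refine ⟨⟨(OnePoint.isOpen_iff_of_notMem (by simpa using h)).2 (isOpen_discrete _)⟩, hs⟩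

theorem OnePoint.isClopen_singleton_coe (d : D) :
    IsClopen ({(d : OnePoint D)} : Set (OnePoint D)) :=
  ⟨isClosed_singleton, (OnePoint.isOpen_iff_of_notMem (by simp)).2 (isOpen_discrete _)⟩

theorem isZeroDimensional_onePoint : IsZeroDimensional (OnePoint D) := by
  refine isTopologicalBasis_of_isOpen_of_nhds (fun s hs => hs.2) fun x O hx hO => ?_
  induction x using OnePoint.rec with
  | infty => exact ⟨O, OnePoint.isClopen_of_infty_mem_of_isOpen hx hO, hx, subset_rfl⟩
  | coe d => exact ⟨{(d : OnePoint D)}, OnePoint.isClopen_singleton_coe d, rfl, by simpa using hx⟩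

theorem OnePoint.exists_finset_of_isClopen {V : Set (OnePoint D)} (hV : IsClopen V) :
    ∃ F : Finset D, V = (↑) '' (F : Set D) ∨ Vᶜ = (↑) '' (F : Set D) := by
  have key : ∀ W : Set (OnePoint D), IsClopen W → OnePoint.infty ∉ W →
      ∃ F : Finset D, W = (↑) '' (F : Set D) := by
    intro W hW h
    have hfin := ((OnePoint.isClosed_iff_of_notMem h).1 hW.1).2.finite_of_discrete
    refine ⟨hfin.toFinset, ?_⟩
    rw [Finite.coe_toFinset, image_preimage_eq_of_subset]
    intro x hx
    rw [← OnePoint.compl_infty]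
    exact fun h' => h (h' ▸ hx)
  by_cases h : OnePoint.infty ∈ V
  · obtain ⟨F, hF⟩ := key Vᶜ hV.compl (by simpa using h)
    exact ⟨F, .inr hF⟩
  · obtain ⟨F, hF⟩ := key V hV h
    exact ⟨F, .inl hF⟩

theorem OnePoint.mk_isClopen_le {D : Type u} [TopologicalSpace D] [DiscreteTopology D]
    {κ : Cardinal.{u}} (hκ : ℵ₀ ≤ κ) (hD : #D ≤ κ) :
    #{V : Set (OnePoint D) // IsClopen V} ≤ κ := by
  classical
  have hF : #(Finset D) ≤ κ :=
    (mk_le_of_surjective (List.toFinset_surjective (α := D))).trans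
      ((mk_list_le_max D).trans (max_le hκ hD))
  let f : Finset D ⊕ Finset D → Set (OnePoint D) :=
    Sum.elim (fun F => (↑) '' (F : Set D)) fun F => ((↑) '' (F : Set D))ᶜ
  have hsub : {V : Set (OnePoint D) | IsClopen V} ⊆ range f := by
    intro V hV
    obtain ⟨F, hF | hF⟩ := OnePoint.exists_finset_of_isClopen hV
    · exact ⟨.inl F, hF.symm⟩
    · exact ⟨.inr F, by simp [f, ← hF]⟩
  calc #{V : Set (OnePoint D) // IsClopen V} ≤ #(range f) := mk_le_mk_of_subset hsub
    _ ≤ #(Finset D ⊕ Finset D) := mk_range_le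
    _ = #(Finset D) + #(Finset D) := by simp
    _ ≤ κ := add_le_of_le hκ hF hF

/-- The action of a group by permutations of a discrete space, as an action on the one-point
compactification. -/
def onePointHom (G : Type*) (D : Type*) [Group G] [MulAction G D] [TopologicalSpace D]
    [DiscreteTopology D] : G →* (OnePoint D ≃ₜ OnePoint D) where
  toFun g := ((MulAction.toPerm g : D ≃ D).toHomeomorphOfDiscrete).onePointCongr
  map_one' := by
    ext x
    induction x using OnePoint.rec with
    | infty => rfl
    | coe d => exact congrArg OnePoint.some (one_smul G d)
  map_mul' g h := by
    ext x
    induction x using OnePoint.rec with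
    | infty => rfl
    | coe d => exact congrArg OnePoint.some (mul_smul g h d)

@[simp]
theorem onePointHom_coe (G : Type*) (D : Type*) [Group G] [MulAction G D] [TopologicalSpace D]
    [DiscreteTopology D] (g : G) (d : D) :
    onePointHom G D g (d : OnePoint D) = ((g • d : D) : OnePoint D) :=
  rfl

end OnePoint

/-! ## Clopen subsets of Čech–Stone compactifications -/

section StoneCech

variable {Z : Type*} [TopologicalSpace Z]

theorem exists_stoneCechUnit_mem {O : Set (StoneCech Z)} (hO : IsOpen O) (h : O.Nonempty) :
    ∃ z, (stoneCechUnit z : StoneCech Z) ∈ O :=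
  denseRange_stoneCechUnit.exists_mem_open hO h

theorem exists_isClopen_stoneCech {A : Set Z} (hA : IsClopen A) :
    ∃ E : Set (StoneCech Z), IsClopen E ∧ ∀ z, stoneCechUnit z ∈ E ↔ z ∈ A := by
  classical
  have hc : Continuous (fun z => decide (z ∈ A)) := (continuous_bool_rng true).2 (by
    convert hA
    ext z
    simp)
  refine ⟨stoneCechExtend hc ⁻¹' {true},
    (isClopen_discrete _).preimage (continuous_stoneCechExtend hc), fun z => ?_⟩
  simp [stoneCechExtend_stoneCechUnit]

/-- By density a clopen set is determined by its trace on `Z`; with `exists_isClopen_stoneCech`,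
clopen subsets of `βZ` and of `Z` correspond. -/
theorem isClopen_stoneCech_subset {E F : Set (StoneCech Z)} (hE : IsClopen E) (hF : IsClopen F)
    (h : ∀ z, (stoneCechUnit z : StoneCech Z) ∈ E → stoneCechUnit z ∈ F) : E ⊆ F := by
  by_contra hEF
  obtain ⟨p, hpE, hpF⟩ := not_subset.1 hEF
  obtain ⟨z, hzE, hzF⟩ := exists_stoneCechUnit_mem (hE.2.inter hF.compl.2) ⟨p, hpE, hpF⟩
  exact hzF (h z hzE)

end StoneCech

/-! ## The remainder of `ω × K` -/

section OmegaProd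

variable {K : Type*} [TopologicalSpace K]

theorem isClopen_nat_prod {A : Set (ℕ × K)} (h : ∀ n, IsClopen {k | (n, k) ∈ A}) : IsClopen A := by
  classical
  have : Continuous (fun z : ℕ × K => decide (z ∈ A)) :=
    continuous_prod_of_discrete_left.2 fun n => (continuous_bool_rng true).2 (by
      convert h n
      ext k
      simp)
  convert (isClopen_discrete {true}).preimage this
  ext z
  simp

theorem IsClopen.isClopen_slice {E : Set (StoneCech (ℕ × K))} (hE : IsClopen E) (n : ℕ) :
    IsClopen {k : K | stoneCechUnit (n, k) ∈ E} :=
  hE.preimage (continuous_stoneCechUnit.comp (Continuous.prodMk_right n))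

theorem exists_isClopen_level (K : Type*) [TopologicalSpace K] (n : ℕ) :
    ∃ E : Set (StoneCech (ℕ × K)), IsClopen E ∧ ∀ z, stoneCechUnit z ∈ E ↔ z.1 < n :=
  exists_isClopen_stoneCech (A := {z : ℕ × K | z.1 < n})
    ((isClopen_discrete (Iio n)).preimage continuous_fst)

variable [CompactSpace K]

/-- The trace of `E` on finitely many levels is compact, so its image is closed; it is also dense in
`E`. -/
theorem isClopen_stoneCech_subset_range {E : Set (StoneCech (ℕ × K))} (hE : IsClopen E) {n : ℕ}
    (h : ∀ z, stoneCechUnit z ∈ E → z.1 < n) :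
    E ⊆ range (stoneCechUnit : ℕ × K → StoneCech (ℕ × K)) := by
  have hC : IsCompact (stoneCechUnit ⁻¹' E : Set (ℕ × K)) :=
    ((finite_Iio n).isCompact.prod isCompact_univ).of_isClosed_subset
      (hE.1.preimage continuous_stoneCechUnit) fun z hz => ⟨h z hz, mem_univ _⟩
  have hC' := (hC.image continuous_stoneCechUnit).isClosed
  by_contra hE'
  obtain ⟨p, hpE, hp⟩ := not_subset.1 hE'
  obtain ⟨z, hzE, hz⟩ := exists_stoneCechUnit_mem (hE.2.inter hC'.isOpen_compl)
    ⟨p, hpE, fun hp' => hp (image_subset_range _ _ hp')⟩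
  exact hz ⟨z, hzE, rfl⟩

theorem isOpen_range_stoneCechUnit :
    IsOpen (range (stoneCechUnit : ℕ × K → StoneCech (ℕ × K))) := by
  rw [isOpen_iff_mem_nhds]
  rintro _ ⟨z, rfl⟩
  obtain ⟨E, hE, hEz⟩ := exists_isClopen_level K (z.1 + 1)
  exact mem_of_superset (hE.2.mem_nhds ((hEz z).2 z.1.lt_succ_self))
    (isClopen_stoneCech_subset_range hE fun z => (hEz z).1)

instance : CompactSpace (CechStoneRemainder (ℕ × K)) :=
  isCompact_iff_compactSpace.1 (isOpen_range_stoneCechUnit (K := K)).isClosed_compl.isCompact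

theorem isClosedEmbedding_remainder_val :
    IsClosedEmbedding (Subtype.val : CechStoneRemainder (ℕ × K) → StoneCech (ℕ × K)) :=
  continuous_subtype_val.isClosedEmbedding Subtype.val_injective

omit [CompactSpace K] in
theorem exists_level_of_subset_range {E : Set (StoneCech (ℕ × K))} (hE : IsClopen E)
    (h : E ⊆ range (stoneCechUnit : ℕ × K → StoneCech (ℕ × K))) :
    ∃ n, ∀ z, stoneCechUnit z ∈ E → z.1 < n := by
  choose L hL hLz using exists_isClopen_level K
  obtain ⟨n, hn⟩ := hE.1.isCompact.elim_directed_cover L (fun n => (hL n).2)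
    (fun p hp => by
      obtain ⟨z, rfl⟩ := h hp
      exact mem_iUnion.2 ⟨z.1 + 1, (hLz _ _).2 z.1.lt_succ_self⟩)
    (Monotone.directed_le fun m n hmn => isClopen_stoneCech_subset (hL m) (hL n) fun z hz =>
      (hLz n z).2 (((hLz m z).1 hz).trans_le hmn))
  exact ⟨n, fun z hz => (hLz n z).1 (hn hz)⟩

/-- `E \ F` misses the remainder exactly when it meets only finitely many levels. This is the
dictionary between clopen sets of the remainder and sequences of slices modulo finite. -/
theorem remainder_preimage_subset_iff {E F : Set (StoneCech (ℕ × K))} (hE : IsClopen E)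
    (hF : IsClopen F) :
    (Subtype.val ⁻¹' E : Set (CechStoneRemainder (ℕ × K))) ⊆ Subtype.val ⁻¹' F ↔
      ∃ n, ∀ z : ℕ × K, n ≤ z.1 → stoneCechUnit z ∈ E → stoneCechUnit z ∈ F := by
  constructor
  · intro h
    obtain ⟨n, hn⟩ := exists_level_of_subset_range (hE.diff hF) fun p hp => by
      by_contra hp'
      exact hp.2 (h (show (⟨p, hp'⟩ : CechStoneRemainder (ℕ × K)) ∈ _ from hp.1))
    exact ⟨n, fun z hz hzE => by_contra fun hzF => (hn z ⟨hzE, hzF⟩).not_ge hz⟩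
  · rintro ⟨n, hn⟩ p hpE
    by_contra hpF
    exact p.2 (isClopen_stoneCech_subset_range (hE.diff hF)
      (fun z hz => not_le.1 fun hnz => hz.2 (hn z hnz hz.1)) ⟨hpE, hpF⟩)

theorem remainder_preimage_nonempty {E : Set (StoneCech (ℕ × K))} (hE : IsClopen E)
    (h : ∀ n, ∃ z : ℕ × K, n ≤ z.1 ∧ stoneCechUnit z ∈ E) :
    (Subtype.val ⁻¹' E : Set (CechStoneRemainder (ℕ × K))).Nonempty := by
  by_contra hne
  obtain ⟨n, hn⟩ := (remainder_preimage_subset_iff hE isClopen_empty).1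
    (not_nonempty_iff_eq_empty.1 hne).subset
  obtain ⟨z, hz, hzE⟩ := h n
  exact hn z hz hzE

theorem exists_level_mem_of_mem_isOpen (p : CechStoneRemainder (ℕ × K))
    {O : Set (StoneCech (ℕ × K))} (hO : IsOpen O) (hp : p.1 ∈ O) (n : ℕ) :
    ∃ z : ℕ × K, n ≤ z.1 ∧ stoneCechUnit z ∈ O := by
  obtain ⟨L, hL, hLz⟩ := exists_isClopen_level K n
  have hpL : p.1 ∉ L := fun h =>
    p.2 (isClopen_stoneCech_subset_range hL (fun z hz => (hLz z).1 hz) h)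
  obtain ⟨z, hzO, hz⟩ := exists_stoneCechUnit_mem (hO.inter hL.compl.2) ⟨p.1, hp, hpL⟩
  exact ⟨z, not_lt.1 fun h => hz ((hLz z).2 h), hzO⟩

variable [T2Space K] [TotallyDisconnectedSpace K]

/-- Take a Urysohn function for `p`, `q`, choose on each level a clopen set between `f ≤ 1/3` and `f
< 2/3`, and glue: discreteness of `ω` keeps the union clopen. -/
instance : TotallyDisconnectedSpace (StoneCech (ℕ × K)) := by
  suffices TotallySeparatedSpace (StoneCech (ℕ × K)) from inferInstance
  refine totallySeparatedSpace_iff_exists_isClopen.2 fun p q hpq => ?_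
  obtain ⟨f, hfp, hfq, -⟩ := exists_continuous_zero_one_of_isClosed
    (isClosed_singleton (x := p)) (isClosed_singleton (x := q)) (disjoint_singleton.2 hpq)
  have hf (n : ℕ) : Continuous fun k : K => f (stoneCechUnit (n, k)) :=
    f.continuous.comp (continuous_stoneCechUnit.comp (Continuous.prodMk_right n))
  have hA : ∀ n : ℕ, ∃ A : Set K, IsClopen A ∧ {k | f (stoneCechUnit (n, k)) ≤ 1 / 3} ⊆ A ∧
      A ⊆ {k | f (stoneCechUnit (n, k)) < 2 / 3} := fun n =>
    exists_clopen_of_closed_subset_open (isClosed_le (hf n) continuous_const)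
      (isOpen_lt (hf n) continuous_const) fun k hk =>
        lt_of_le_of_lt (show f (stoneCechUnit (n, k)) ≤ 1 / 3 from hk) (by norm_num)
  choose A hA hAl hAu using hA
  obtain ⟨E, hE, hEz⟩ := exists_isClopen_stoneCech (A := {z : ℕ × K | z.2 ∈ A z.1})
    (isClopen_nat_prod hA)
  refine ⟨E, hE, ?_, fun hqE => ?_⟩
  · by_contra hpE
    obtain ⟨z, hz, hzE⟩ := exists_stoneCechUnit_mem
      ((isOpen_lt f.continuous (continuous_const (y := (1 / 3 : ℝ)))).inter hE.compl.2)
      ⟨p, by simp [hfp rfl], hpE⟩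
    exact hzE ((hEz z).2 (hAl z.1 (show f (stoneCechUnit z) ≤ 1 / 3 from le_of_lt hz)))
  · obtain ⟨z, hz, hzE⟩ := exists_stoneCechUnit_mem
      ((isOpen_lt (continuous_const (y := (2 / 3 : ℝ))) f.continuous).inter hE.2)
      ⟨q, by norm_num [hfq rfl], hqE⟩
    have hz' : f (stoneCechUnit z) < 2 / 3 := hAu z.1 ((hEz z).1 hzE)
    exact lt_asymm hz hz'

theorem exists_isClopen_remainder {C O : Set (CechStoneRemainder (ℕ × K))} (hC : IsClosed C)
    (hO : IsOpen O) (hCO : C ⊆ O) :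
    ∃ E : Set (StoneCech (ℕ × K)), IsClopen E ∧ C ⊆ Subtype.val ⁻¹' E ∧
      Subtype.val ⁻¹' E ⊆ O := by
  have hv := isClosedEmbedding_remainder_val (K := K)
  obtain ⟨E, hE, hCE, hEO⟩ := exists_clopen_of_closed_subset_open (hv.isClosedMap C hC)
    (hv.isClosedMap _ hO.isClosed_compl).isOpen_compl (by
      rintro _ ⟨p, hp, rfl⟩ ⟨q, hq, hqp⟩
      exact hq (Subtype.val_injective hqp ▸ hCO hp))
  refine ⟨E, hE, image_subset_iff.1 hCE, fun p hp => ?_⟩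
  by_contra hpO
  exact hEO hp (mem_image_of_mem _ hpO)

theorem IsClopen.exists_remainder_preimage {S : Set (CechStoneRemainder (ℕ × K))}
    (hS : IsClopen S) :
    ∃ E : Set (StoneCech (ℕ × K)), IsClopen E ∧ Subtype.val ⁻¹' E = S := by
  obtain ⟨E, hE, h1, h2⟩ := exists_isClopen_remainder hS.1 hS.2 subset_rfl
  exact ⟨E, hE, h2.antisymm h1⟩

/-! ### The `F`-space property -/

/-- A cozero-set is a countable union of clopen traces. Tietze extends `h` from each trace to `βZ`;
these extensions are pasted on `ω × K` along disjointed pieces, and the result is extended to `βZ`.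
-/
theorem isFSpace_remainder : IsFSpace (CechStoneRemainder (ℕ × K)) := by
  classical
  rintro s ⟨g, hs⟩ h
  have hE : ∀ n : ℕ, ∃ E : Set (StoneCech (ℕ × K)), IsClopen E ∧
      {x : CechStoneRemainder (ℕ × K) | 1 / ((n : ℝ) + 1) ≤ |g x|} ⊆ Subtype.val ⁻¹' E ∧
      Subtype.val ⁻¹' E ⊆ s := fun n =>
    exists_isClopen_remainder (isClosed_le continuous_const g.continuous.abs)
      (hs ▸ isOpen_ne_fun g.continuous continuous_const) fun x (hx : _ ≤ |g x|) => by
        rw [hs]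
        exact abs_pos.1 ((by positivity : (0 : ℝ) < 1 / (n + 1)).trans_le hx)
  choose E hE hgE hEs using hE
  have hext : ∀ n, ∃ f : StoneCech (ℕ × K) →ᵇ ℝ, ‖f‖ ≤ ‖h‖ ∧
      ∀ x : s, x.1.1 ∈ E n → f x.1.1 = h x := by
    intro n
    let T := {x : CechStoneRemainder (ℕ × K) // x.1 ∈ E n}
    let i : C(T, s) := ⟨fun x => ⟨x.1, hEs n x.2⟩, by fun_prop⟩
    have he : IsClosedEmbedding fun x : T => x.1.1 :=
      (isClosedEmbedding_remainder_val (K := K)).comp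
        ((hE n).1.preimage continuous_subtype_val).isClosedEmbedding_subtypeVal
    obtain ⟨f, hf, hfe⟩ :=
      BoundedContinuousFunction.exists_extension_norm_eq_of_isClosedEmbedding
        (h.compContinuous i) he
    refine ⟨f, hf.le.trans ((BoundedContinuousFunction.norm_le (norm_nonneg _)).2
      fun x => h.norm_coe_le_norm _), fun x hx => ?_⟩
    exact congrFun hfe ⟨x.1, hx⟩
  choose f hf hfh using hext
  let A := disjointed E
  have hA (n) : IsClopen (A n) := disjointedRec (fun _ _ h' => h'.diff (hE _)) (hE n)
  -- Level `m` uses only the pieces `0, …, m`, so the sum is finite and continuous there; the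
  -- remainder does not notice the omitted levels.
  let H : ℕ × K → ℝ := fun z =>
    ∑ n ∈ Finset.range (z.1 + 1), (A n).indicator (f n) (stoneCechUnit z)
  have hHA : ∀ n z, n ≤ z.1 → stoneCechUnit z ∈ A n → H z = f n (stoneCechUnit z) := by
    intro n z hn hz
    rw [show H z = _ from Finset.sum_eq_single n ?_ ?_, indicator_of_mem hz]
    · intro m _ hmn
      exact indicator_of_notMem
        (fun hm => (disjoint_disjointed E hmn).le_bot (show _ ∈ A m ⊓ A n from ⟨hm, hz⟩)) _
    · intro hn'
      exact absurd (Finset.mem_range.2 (Nat.lt_succ_of_le hn)) hn'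
  have hHb : ∀ z, H z ∈ Metric.closedBall (0 : ℝ) ‖h‖ := by
    intro z
    rw [mem_closedBall_zero_iff]
    by_cases hz : ∃ n ≤ z.1, (stoneCechUnit z : StoneCech (ℕ × K)) ∈ A n
    · obtain ⟨n, hn, hzn⟩ := hz
      rw [hHA n z hn hzn]
      exact ((f n).norm_coe_le_norm _).trans (hf n)
    · rw [show H z = 0 from Finset.sum_eq_zero fun n hn => indicator_of_notMem
        (fun hzn => hz ⟨n, Nat.lt_succ_iff.1 (Finset.mem_range.1 hn), hzn⟩) _, norm_zero]
      exact norm_nonneg _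
  have hHc : Continuous H := continuous_prod_of_discrete_left.2 fun m =>
    continuous_finsetSum (Finset.range (m + 1)) fun n _ => ((f n).continuous.indicator
      (fun a ha => by simp [(hA n).frontier_eq] at ha)).comp
        (continuous_stoneCechUnit.comp (Continuous.prodMk_right m))
  have : CompactSpace (Metric.closedBall (0 : ℝ) ‖h‖) :=
    isCompact_iff_compactSpace.1 (isCompact_closedBall _ _)
  have hHc' : Continuous fun z => (⟨H z, hHb z⟩ : Metric.closedBall (0 : ℝ) ‖h‖) :=
    hHc.subtype_mk _
  let F : C(StoneCech (ℕ × K), ℝ) :=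
    ⟨fun p => (stoneCechExtend hHc' p).1,
      continuous_subtype_val.comp (continuous_stoneCechExtend hHc')⟩
  have hF (z) : F (stoneCechUnit z) = H z :=
    congrArg Subtype.val (stoneCechExtend_stoneCechUnit hHc' z)
  refine ⟨BoundedContinuousFunction.mkOfCompact
    (F.comp ⟨Subtype.val, continuous_subtype_val⟩), fun x => ?_⟩
  change F x.1.1 = h x
  obtain ⟨n, hn⟩ : ∃ n, x.1.1 ∈ A n := by
    rw [← mem_iUnion, iUnion_disjointed, mem_iUnion]
    have hx : g x.1 ≠ 0 := hs.subset x.2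
    obtain ⟨n, hn⟩ := exists_nat_one_div_lt (abs_pos.2 hx)
    exact ⟨n, hgE n hn.le⟩
  rw [← hfh n x (disjointed_subset E n hn)]
  -- If `F` and `f n` differed at `x`, they would differ at points of `A n` on some level at least
  -- `n`, where `H` is `f n`.
  by_contra hne
  obtain ⟨z, hz, hzA, hzF⟩ := exists_level_mem_of_mem_isOpen x.1
    ((hA n).2.inter (isOpen_ne_fun F.continuous (f n).continuous)) ⟨hn, hne⟩ n
  exact hzF ((hF z).trans (hHA n z hz hzA))

/-! ### Nonempty `Gδ`-sets -/

/-- Diagonalize: on level `φ n` keep the points lying in the first `n + 1` clopen sets `E j`. For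
any infinite set `I` of indices, the levels `φ n` with `n ∈ I` give a nonempty clopen set of the
remainder inside every `E j`. -/
theorem infinite_interior_remainder {s : Set (CechStoneRemainder (ℕ × K))} (hs : IsGδ s)
    (hne : s.Nonempty) : (interior s).Infinite := by
  obtain ⟨p, hp⟩ := hne
  obtain ⟨O, hO, rfl⟩ := hs.eq_iInter_nat
  have hE : ∀ n, ∃ E : Set (StoneCech (ℕ × K)), IsClopen E ∧ p.1 ∈ E ∧
      Subtype.val ⁻¹' E ⊆ O n := fun n => by
    obtain ⟨E, hE, hpE, hEO⟩ := exists_isClopen_remainder isClosed_singleton (hO n)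
      (singleton_subset_iff.2 (mem_iInter.1 hp n))
    exact ⟨E, hE, hpE rfl, hEO⟩
  choose E hE hpE hEO using hE
  obtain ⟨φ, hφ, hφE⟩ := extraction_forall_of_frequently
    (P := fun n m => ∃ k : K, ∀ j ≤ n, stoneCechUnit (m, k) ∈ E j) fun n =>
      frequently_atTop.2 fun a => by
        obtain ⟨z, hz, hzE⟩ := exists_level_mem_of_mem_isOpen p
          ((finite_Iic n).isOpen_biInter fun j _ => (hE j).2)
          (mem_iInter₂.2 fun j _ => hpE j) a
        exact ⟨z.1, hz, z.2, fun j hj => mem_iInter₂.1 hzE j hj⟩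
  let A : Set ℕ → Set (ℕ × K) := fun I =>
    {z | ∃ n ∈ I, z.1 = φ n ∧ ∀ j ≤ n, stoneCechUnit z ∈ E j}
  have hA (I) : IsClopen (A I) := by
    refine isClopen_nat_prod fun m => ?_
    by_cases hm : ∃ n ∈ I, m = φ n
    · obtain ⟨n, hn, rfl⟩ := hm
      convert (finite_Iic n).isClopen_biInter fun j _ => (hE j).isClopen_slice (φ n)
      ext k
      simp only [mem_iInter]
      constructor
      · rintro ⟨n', -, h, hk⟩
        rw [hφ.injective h]
        exact fun i hi => show stoneCechUnit (φ n', k) ∈ E i from h ▸ hk i hi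
      · exact fun hk => ⟨n, hn, rfl, hk⟩
    · convert isClopen_empty
      exact eq_empty_of_forall_notMem fun k ⟨n, hn, h, _⟩ => hm ⟨n, hn, h⟩
  choose F hF hFz using fun I => exists_isClopen_stoneCech (hA I)
  have hsub (I) : (Subtype.val ⁻¹' F I : Set (CechStoneRemainder (ℕ × K))) ⊆
      interior (⋂ n, O n) := by
    refine interior_maximal (subset_iInter fun j => ?_)
      ((hF I).2.preimage continuous_subtype_val)
    refine ((remainder_preimage_subset_iff (hF I) (hE j)).2 ⟨φ j, fun z hz hzF => ?_⟩).trans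
      (hEO j)
    obtain ⟨n, -, hn, hzE⟩ := (hFz I z).1 hzF
    exact hzE j (hφ.le_iff_le.1 (hn ▸ hz))
  -- The fibres of `n ↦ n.unpair.1` split `ω` into infinitely many infinite index sets, hence yield
  -- infinitely many disjoint clopen sets.
  have hnonempty (i : ℕ) : (Subtype.val ⁻¹' F {n | n.unpair.1 = i} :
      Set (CechStoneRemainder (ℕ × K))).Nonempty := by
    refine remainder_preimage_nonempty (hF _) fun a => ?_
    obtain ⟨k, hk⟩ := hφE (Nat.pair i a)
    refine ⟨(φ (Nat.pair i a), k), (Nat.right_le_pair i a).trans hφ.le_apply, ?_⟩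
    exact (hFz _ _).2 ⟨Nat.pair i a, by simp, rfl, hk⟩
  choose x hx using hnonempty
  refine infinite_of_injective_forall_mem (f := x) (fun i j hij => ?_) fun i => hsub _ (hx i)
  obtain ⟨z, -, hzi, hzj⟩ := exists_level_mem_of_mem_isOpen (x i) ((hF _).2.inter (hF _).2)
    ⟨hx i, hij ▸ hx j⟩ 0
  obtain ⟨n, hn, hzn, -⟩ := (hFz _ _).1 hzi
  obtain ⟨m, hm, hzm, -⟩ := (hFz _ _).1 hzj
  rw [← show n.unpair.1 = i from hn, ← show m.unpair.1 = j from hm,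
    hφ.injective (hzn.symm.trans hzm)]

end OmegaProd

/-! ### The weight of the remainder -/

/-- The codes of the initial segments of a binary sequence: an almost disjoint family. -/
def initialSegmentCodes (x : ℕ → Bool) : Set ℕ :=
  range fun n => Encodable.encode ((List.range n).map x)

theorem initialSegmentCodes_injective (x : ℕ → Bool) :
    Function.Injective fun n => Encodable.encode ((List.range n).map x) := fun m n h => by
  simpa using congrArg List.length (Encodable.encode_injective h)

theorem infinite_initialSegmentCodes (x : ℕ → Bool) : (initialSegmentCodes x).Infinite :=
  infinite_range_of_injective (initialSegmentCodes_injective x)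

/-- Sequences differing at `i` share only initial segments of length at most `i`. -/
theorem finite_initialSegmentCodes_inter {x y : ℕ → Bool} (hxy : x ≠ y) :
    (initialSegmentCodes x ∩ initialSegmentCodes y).Finite := by
  obtain ⟨i, hi⟩ := Function.ne_iff.1 hxy
  refine ((finite_Iic i).image fun n => Encodable.encode ((List.range n).map x)).subset ?_
  rintro _ ⟨⟨m, rfl⟩, n, hn⟩
  refine ⟨m, mem_Iic.2 (not_lt.1 fun him => hi ?_), rfl⟩
  have h := Encodable.encode_injective hn
  have hmn : n = m := by simpa using congrArg List.length h
  subst hmn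
  exact (List.map_inj_left.1 h i (List.mem_range.2 him)).symm

section Weight

variable {K : Type u} [TopologicalSpace K] [CompactSpace K] [T2Space K] [TotallyDisconnectedSpace K]

theorem mk_isClopen_remainder_le (hK : #{V : Set K // IsClopen V} ≤ 𝔠) :
    #{S : Set (CechStoneRemainder (ℕ × K)) // IsClopen S} ≤ 𝔠 := by
  choose E hE hEz using fun c : ℕ → {V : Set K // IsClopen V} =>
    exists_isClopen_stoneCech (A := {z : ℕ × K | z.2 ∈ (c z.1).1})
      (isClopen_nat_prod fun n => (c n).2)
  let F : (ℕ → {V : Set K // IsClopen V}) →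
      {S : Set (CechStoneRemainder (ℕ × K)) // IsClopen S} :=
    fun c => ⟨Subtype.val ⁻¹' E c, (hE c).preimage continuous_subtype_val⟩
  have hF : Function.Surjective F := by
    rintro ⟨S, hS⟩
    obtain ⟨E', hE', rfl⟩ := hS.exists_remainder_preimage
    let c : ℕ → {V : Set K // IsClopen V} := fun n => ⟨_, hE'.isClopen_slice n⟩
    refine ⟨c, Subtype.ext (congrArg (preimage Subtype.val) ?_)⟩
    exact (isClopen_stoneCech_subset (hE _) hE' fun z hz => (hEz c z).1 hz).antisymm
      (isClopen_stoneCech_subset hE' (hE _) fun z hz => (hEz c z).2 hz)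
  refine (mk_le_of_surjective hF).trans ?_
  rw [mk_arrow, mk_nat, lift_aleph0, lift_uzero, ← continuum_power_aleph0]
  exact power_le_power_right hK

omit [T2Space K] [TotallyDisconnectedSpace K] in
-- Almost disjoint sets of levels have disjoint traces on the remainder, so this is a family of `𝔠`
-- disjoint nonempty open sets, each containing its own nonempty basic set.
theorem continuum_le_mk_of_isTopologicalBasis [Nonempty K]
    {B : Set (Set (CechStoneRemainder (ℕ × K)))} (hB : IsTopologicalBasis B) : 𝔠 ≤ #B := by
  choose E hE hEz using fun x : ℕ → Bool =>
    exists_isClopen_stoneCech (A := {z : ℕ × K | z.1 ∈ initialSegmentCodes x})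
      ((isClopen_discrete _).preimage continuous_fst)
  have hsub : ∀ x, ∃ b : B, b.1.Nonempty ∧ b.1 ⊆ Subtype.val ⁻¹' E x := fun x => by
    obtain ⟨p, hp⟩ := remainder_preimage_nonempty (hE x) fun n => by
      obtain ⟨m, hm, hnm⟩ := (infinite_initialSegmentCodes x).exists_gt n
      exact ⟨(m, Classical.arbitrary K), hnm.le, (hEz x _).2 hm⟩
    obtain ⟨b, hb, hpb, hbE⟩ := hB.exists_subset_of_mem_open hp
      ((hE x).2.preimage continuous_subtype_val)
    exact ⟨⟨b, hb⟩, ⟨p, hpb⟩, hbE⟩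
  choose b hb hbE using hsub
  have hinj : Function.Injective b := fun x y hxy => by
    by_contra hne
    obtain ⟨p, hp⟩ := hb x
    obtain ⟨a, ha⟩ := (finite_initialSegmentCodes_inter hne).bddAbove
    obtain ⟨z, hz, hzx, hzy⟩ := exists_level_mem_of_mem_isOpen p ((hE x).2.inter (hE y).2)
      ⟨hbE x hp, hbE y (hxy ▸ hp)⟩ (a + 1)
    have hza : z.1 ≤ a := ha ⟨(hEz x z).1 hzx, (hEz y z).1 hzy⟩
    omega
  have := lift_mk_le_lift_mk_of_injective hinj
  simpa using this

theorem topWeight_remainder [Nonempty K] (hK : #{V : Set K // IsClopen V} ≤ 𝔠) :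
    topWeight (CechStoneRemainder (ℕ × K)) = 𝔠 := by
  have hB := isZeroDimensional_of_totallyDisconnectedSpace (CechStoneRemainder (ℕ × K))
  have : Nonempty {B : Set (Set (CechStoneRemainder (ℕ × K))) // IsTopologicalBasis B} :=
    ⟨⟨_, hB⟩⟩
  exact le_antisymm ((ciInf_le' (fun B : {B : Set (Set (CechStoneRemainder (ℕ × K))) //
    IsTopologicalBasis B} => #B.1) ⟨_, hB⟩).trans (mk_isClopen_remainder_le hK))
    (le_ciInf fun B => continuum_le_mk_of_isTopologicalBasis B.2)

theorem isParovicenko_remainder [Nonempty K] (hK : #{V : Set K // IsClopen V} ≤ 𝔠) :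
    IsParovicenko (CechStoneRemainder (ℕ × K)) where
  compact := inferInstance
  t2 := inferInstance
  zeroDimensional := isZeroDimensional_of_totallyDisconnectedSpace _
  fSpace := isFSpace_remainder
  weight := topWeight_remainder hK
  infinite_interior _ hs hne := infinite_interior_remainder hs hne

end Weight

/-! ## Representing the `Gδ`-modification of a group by permutations -/

theorem exists_isTopologicalBasis_mk_eq (X : Type*) [TopologicalSpace X] :
    ∃ B : Set (Set X), IsTopologicalBasis B ∧ #B = topWeight X := by
  have : Nonempty {B : Set (Set X) // IsTopologicalBasis B} := ⟨⟨_, isTopologicalBasis_opens⟩⟩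
  obtain ⟨B, hB⟩ := ciInf_mem fun B : {B : Set (Set X) // IsTopologicalBasis B} => #B.1
  exact ⟨B.1, B.2, hB⟩

/-- A coset `gN` is the intersection of the `g U n`, so it contains an intersection of countably
many basic neighbourhoods of `g`; that sequence determines the coset. -/
theorem mk_quotient_le_of_isGδ {G : Type u} [Group G] [TopologicalSpace G] [IsTopologicalGroup G]
    {B : Set (Set G)} (hB : IsTopologicalBasis B) {N : Subgroup G} (hN : IsGδ (N : Set G)) :
    #(G ⧸ N) ≤ #(ℕ → B) := by
  obtain ⟨U, hU, hNU⟩ := hN.eq_iInter_nat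
  have h : ∀ q : G ⧸ N, ∃ b : ℕ → B, (⋂ n, (b n).1).Nonempty ∧
      ∀ x ∈ ⋂ n, (b n).1, (x : G ⧸ N) = q := by
    intro q
    obtain ⟨g, rfl⟩ := QuotientGroup.mk_surjective q
    have hg : ∀ n, ∃ b : B, g ∈ b.1 ∧ b.1 ⊆ {x | g⁻¹ * x ∈ U n} := fun n => by
      obtain ⟨b, hb, hgb, hbU⟩ := hB.exists_subset_of_mem_open
        (show g ∈ {x | g⁻¹ * x ∈ U n} from by
          have h1 : (1 : G) ∈ ⋂ n, U n := hNU ▸ N.one_mem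
          simpa using mem_iInter.1 h1 n) ((hU n).preimage (continuous_const_mul g⁻¹))
      exact ⟨⟨b, hb⟩, hgb, hbU⟩
    choose b hgb hbU using hg
    refine ⟨b, ⟨g, mem_iInter.2 hgb⟩, fun x hx => Eq.symm (QuotientGroup.eq.2 ?_)⟩
    rw [← SetLike.mem_coe, hNU]
    exact mem_iInter.2 fun n => hbU n (mem_iInter.1 hx n)
  choose b hb hbq using h
  refine mk_le_of_injective (f := b) fun p q hpq => ?_
  obtain ⟨x, hx⟩ := hb p
  exact (hbq p x hx).symm.trans (hbq q x (hpq ▸ hx))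

/-- The summands of `D` are indexed by sequences of basic neighbourhoods of 1. Elements carrying
`xN` to `yN` form `y N x⁻¹`, no element carries one summand to another, and the trivial coset has
stabilizer `N`. -/
theorem exists_mulAction_isGδ (G : Type u) [Group G] [TopologicalSpace G] [IsTopologicalGroup G]
    (hG : topWeight G = 𝔠) :
    ∃ (D : Type u) (_ : MulAction G D), #D ≤ 𝔠 ∧ (∀ d e : D, IsGδ {g : G | g • d = e}) ∧
      ∀ s : Set G, IsGδ s → 1 ∈ s → ∃ d : D, {g : G | g • d = d} ⊆ s := by
  obtain ⟨B, hB, hBG⟩ := exists_isTopologicalBasis_mk_eq G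
  have hBω : #(ℕ → B) ≤ 𝔠 := by
    rw [mk_arrow, mk_nat, lift_aleph0, lift_uzero, hBG, hG, continuum_power_aleph0]
  let J := {b : ℕ → B // ∀ n, (1 : G) ∈ (b n).1}
  choose N hN hNb using fun b : J => exists_isGδ_subgroup (fun n => (b.1 n).1) fun n =>
    hB.mem_nhds (b.1 n).2 (b.2 n)
  refine ⟨Σ b : J, G ⧸ N b, inferInstance, ?_, ?_, ?_⟩
  · rw [mk_sigma]
    calc Cardinal.sum (fun b : J => #(G ⧸ N b)) ≤ Cardinal.sum fun _ : J => 𝔠 :=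
          sum_le_sum _ _ fun b => (mk_quotient_le_of_isGδ hB (hN b)).trans hBω
      _ = #J * 𝔠 := by rw [sum_const']
      _ ≤ 𝔠 * 𝔠 := mul_le_mul' ((mk_subtype_le _).trans hBω) le_rfl
      _ = 𝔠 := continuum_mul_self
  · rintro ⟨b, p⟩ ⟨c, q⟩
    obtain ⟨x, rfl⟩ := QuotientGroup.mk_surjective p
    obtain ⟨y, rfl⟩ := QuotientGroup.mk_surjective q
    by_cases hbc : b = c
    · subst hbc
      convert (hN b).preimage (f := fun g : G => (g * x)⁻¹ * y) (by fun_prop)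
      ext g
      change (⟨b, ((g * x : G) : G ⧸ N b)⟩ : Σ b : J, G ⧸ N b) = ⟨b, (y : G ⧸ N b)⟩ ↔
        (g * x)⁻¹ * y ∈ N b
      rw [← QuotientGroup.eq]
      exact ⟨fun h => eq_of_heq (Sigma.mk.inj h).2, fun h => h ▸ rfl⟩
    · convert IsGδ.empty (X := G)
      exact eq_empty_of_forall_notMem fun g hg => hbc (congrArg Sigma.fst hg)
  · intro s hs h1
    obtain ⟨U, hU, rfl⟩ := hs.eq_iInter_nat
    have hb : ∀ n, ∃ b : B, (1 : G) ∈ b.1 ∧ b.1 ⊆ U n := fun n => by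
      obtain ⟨b, hb, h1b, hbU⟩ := hB.exists_subset_of_mem_open (mem_iInter.1 h1 n) (hU n)
      exact ⟨⟨b, hb⟩, h1b, hbU⟩
    choose b h1b hbU using hb
    refine ⟨⟨⟨b, h1b⟩, ((1 : G) : G ⧸ N _)⟩, fun g hg => mem_iInter.2 fun n =>
      hbU n (hNb ⟨b, h1b⟩ n ?_)⟩
    have h : ((g * 1 : G) : G ⧸ N ⟨b, h1b⟩) = ((1 : G) : G ⧸ N ⟨b, h1b⟩) :=
      eq_of_heq (Sigma.mk.inj hg).2
    simpa using QuotientGroup.eq.1 h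

/-! ### Embedding the `Gδ`-modification into the homeomorphism group of `OnePoint D` -/

theorem Homeomorph.preimage_eq_of_eqOn_symm {X : Type*} [TopologicalSpace X] {f g : X ≃ₜ X}
    {V : Set X} (h : EqOn f.symm g.symm V) : f ⁻¹' V = g ⁻¹' V := by
  have key : ∀ {f g : X ≃ₜ X}, EqOn f.symm g.symm V → f ⁻¹' V ⊆ g ⁻¹' V := by
    intro f g h x hx
    have hx' : x = g.symm (f x) := by simpa using h hx
    rw [hx', mem_preimage, g.apply_symm_apply]
    exact hx
  exact (key h).antisymm (key h.symm)

/-- The identity map from the `Gδ`-modification of a group to the group. -/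
def GDeltaMod.equiv (G : Type*) [Group G] : GDeltaMod G ≃* G :=
  MulEquiv.refl G

/-- The preimage of `V` depends only on the inverse map on `V`, or equally on `Vᶜ`, and one of the
two is a finite subset of `D`. Conversely, the singletons `{d}` detect stabilizers. -/
theorem isInducing_onePointHom {G D : Type*} [Group G] [TopologicalSpace G] [IsTopologicalGroup G]
    [MulAction G D] [TopologicalSpace D] [DiscreteTopology D]
    (hD : ∀ d e : D, IsGδ {g : G | g • d = e})
    (hG : ∀ s : Set G, IsGδ s → 1 ∈ s → ∃ d : D, {g : G | g • d = d} ⊆ s) :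
    IsInducing fun g : GDeltaMod G => onePointHom G D (GDeltaMod.equiv G g) := by
  have : TotallyDisconnectedSpace (OnePoint D) := isZeroDimensional_onePoint.totallyDisconnectedSpace
  have hsymm (g : G) (d : D) :
      (onePointHom G D g).symm (d : OnePoint D) = ((g⁻¹ • d : D) : OnePoint D) :=
    (onePointHom G D g).symm_apply_eq.2 (by simp)
  refine isInducing_iff_nhds.2 fun g => ?_
  rw [nhds_homeomorph_eq, comap_iInf]
  simp only [comap_principal]
  apply le_antisymm
  · rw [le_iInf_iff]
    rintro ⟨V, hV⟩
    rw [le_principal_iff]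
    obtain ⟨F, hF⟩ := OnePoint.exists_finset_of_isClopen hV
    have hmem : (⋂ d ∈ F, {h : G | h⁻¹ • d = (GDeltaMod.equiv G g)⁻¹ • d}) ∈ 𝓝 g := by
      refine mem_nhds_gDeltaMod_iff.2 ⟨_, .biInter (F.countable_toSet) fun d _ =>
        (hD d ((GDeltaMod.equiv G g)⁻¹ • d)).preimage continuous_inv, ?_, subset_rfl⟩
      exact mem_iInter₂.2 fun d _ => rfl
    refine mem_of_superset hmem fun h hh => ?_
    have heq : EqOn (onePointHom G D (GDeltaMod.equiv G h)).symm
        (onePointHom G D (GDeltaMod.equiv G g)).symm ((↑) '' (F : Set D)) := by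
      rintro _ ⟨d, hd, rfl⟩
      rw [hsymm, hsymm]
      exact congrArg _ (mem_iInter₂.1 hh d hd)
    rcases hF with hF | hF
    · exact Homeomorph.preimage_eq_of_eqOn_symm (hF ▸ heq)
    · refine compl_injective ?_
      rw [← preimage_compl, ← preimage_compl]
      exact Homeomorph.preimage_eq_of_eqOn_symm (hF ▸ heq)
  · intro s hs
    obtain ⟨t, ht, hgt, hts⟩ := mem_nhds_gDeltaMod_iff.1 hs
    -- Equal preimages of `{d}` say that `k = g * h⁻¹` fixes `d`, and then `k⁻¹ * g = h`.
    obtain ⟨d, hd⟩ := hG {k | k⁻¹ * (GDeltaMod.equiv G g) ∈ t}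
      (ht.preimage (f := fun k : G => k⁻¹ * (GDeltaMod.equiv G g)) (by fun_prop)) (by
        simpa using (show GDeltaMod.equiv G g ∈ t from hgt))
    refine mem_iInf_of_mem ⟨_, OnePoint.isClopen_singleton_coe d⟩
      (mem_principal.2 fun h hh => hts ?_)
    have hh' : onePointHom G D (GDeltaMod.equiv G h) ⁻¹' {(d : OnePoint D)} =
      onePointHom G D (GDeltaMod.equiv G g) ⁻¹' {(d : OnePoint D)} := hh
    have hmem : (((GDeltaMod.equiv G h)⁻¹ • d : D) : OnePoint D) ∈
        onePointHom G D (GDeltaMod.equiv G g) ⁻¹' {(d : OnePoint D)} := by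
      rw [← hh', mem_preimage, onePointHom_coe, smul_inv_smul]
      rfl
    have hfix : ((GDeltaMod.equiv G g) * (GDeltaMod.equiv G h)⁻¹) • d = d := by
      rw [mem_preimage, onePointHom_coe, smul_smul] at hmem
      exact OnePoint.coe_injective hmem
    have hht : ((GDeltaMod.equiv G g) * (GDeltaMod.equiv G h)⁻¹)⁻¹ * GDeltaMod.equiv G g ∈ t :=
      hd hfix
    rwa [mul_inv_rev, inv_inv, inv_mul_cancel_right] at hht

/-! ## The action on the remainder -/

section Remainder

variable {K : Type*} [TopologicalSpace K]

theorem omegaRemainderHom_preimage_eq {f g : K ≃ₜ K} {E : Set (StoneCech (ℕ × K))}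
    (hE : IsClopen E)
    (h : ∀ n, f ⁻¹' {k | stoneCechUnit (n, k) ∈ E} = g ⁻¹' {k | stoneCechUnit (n, k) ∈ E}) :
    omegaRemainderHom K f ⁻¹' (Subtype.val ⁻¹' E) =
      omegaRemainderHom K g ⁻¹' (Subtype.val ⁻¹' E) := by
  have key : ∀ {f g : K ≃ₜ K},
      (∀ n, f ⁻¹' {k | stoneCechUnit (n, k) ∈ E} = g ⁻¹' {k | stoneCechUnit (n, k) ∈ E}) →
      stoneExtension (omegaProdHom K f) ⁻¹' E ⊆ stoneExtension (omegaProdHom K g) ⁻¹' E :=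
    fun {f g} h => isClopen_stoneCech_subset (hE.preimage (continuous_stoneExtension _))
      (hE.preimage (continuous_stoneExtension _)) fun z hz => by
        rw [mem_preimage, stoneExtension_unit] at hz ⊢
        exact (h z.1).subset hz
  exact congrArg (preimage Subtype.val) ((key h).antisymm (key fun n => (h n).symm))

/-- All slices of `E` equal `V`, so an inclusion valid on almost all levels can be read off on a
single one. -/
theorem preimage_eq_of_omegaRemainderHom [CompactSpace K] {f g : K ≃ₜ K} {V : Set K}
    {E : Set (StoneCech (ℕ × K))} (hE : IsClopen E) (hEV : ∀ z, stoneCechUnit z ∈ E ↔ z.2 ∈ V)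
    (h : omegaRemainderHom K f ⁻¹' (Subtype.val ⁻¹' E) =
      omegaRemainderHom K g ⁻¹' (Subtype.val ⁻¹' E)) : f ⁻¹' V = g ⁻¹' V := by
  have key : ∀ {f g : K ≃ₜ K}, omegaRemainderHom K f ⁻¹' (Subtype.val ⁻¹' E) ⊆
      omegaRemainderHom K g ⁻¹' (Subtype.val ⁻¹' E) → f ⁻¹' V ⊆ g ⁻¹' V := by
    intro f g h k hk
    obtain ⟨n, hn⟩ := (remainder_preimage_subset_iff
      (hE.preimage (continuous_stoneExtension (omegaProdHom K f)))
      (hE.preimage (continuous_stoneExtension (omegaProdHom K g)))).1 h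
    have := hn (n, k) le_rfl
    simp only [mem_preimage, stoneExtension_unit, hEV] at this
    exact this hk
  exact (key h.subset).antisymm (key h.symm.subset)

/-- The hypothesis `hT` is needed because a clopen set of the remainder imposes one condition for
each of its countably many slices. -/
theorem isInducing_omegaRemainderHom_comp [CompactSpace K] [T2Space K] [TotallyDisconnectedSpace K]
    {T : Type*} [TopologicalSpace T]
    (hT : ∀ (t : T) (s : ℕ → Set T), (∀ n, s n ∈ 𝓝 t) → ⋂ n, s n ∈ 𝓝 t) {φ : T → (K ≃ₜ K)}
    (hφ : IsInducing φ) : IsInducing fun t => omegaRemainderHom K (φ t) := by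
  refine isInducing_iff_nhds.2 fun t => ?_
  rw [nhds_homeomorph_eq, comap_iInf]
  simp only [comap_principal]
  have hφt := isInducing_iff_nhds.1 hφ t
  rw [nhds_homeomorph_eq, comap_iInf] at hφt
  simp only [comap_principal] at hφt
  apply le_antisymm
  · rw [le_iInf_iff]
    rintro ⟨W, hW⟩
    rw [le_principal_iff]
    obtain ⟨E, hE, rfl⟩ := hW.exists_remainder_preimage
    refine mem_of_superset (hT t (fun n => {t' | φ t' ⁻¹' {k | stoneCechUnit (n, k) ∈ E} =
      φ t ⁻¹' {k | stoneCechUnit (n, k) ∈ E}}) fun n => ?_) fun t' ht' =>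
        omegaRemainderHom_preimage_eq hE fun n => mem_iInter.1 ht' n
    rw [hφt]
    exact mem_iInf_of_mem ⟨_, hE.isClopen_slice n⟩ (mem_principal_self _)
  · rw [hφt, le_iInf_iff]
    rintro ⟨V, hV⟩
    obtain ⟨E, hE, hEz⟩ := exists_isClopen_stoneCech (A := {z : ℕ × K | z.2 ∈ V})
      (hV.preimage continuous_snd)
    refine (iInf_le _ ⟨_, hE.preimage continuous_subtype_val⟩).trans (principal_mono.2 ?_)
    exact fun t' ht' => preimage_eq_of_omegaRemainderHom hE hEz ht'

end Remainder

/-- The topological isomorphism onto its range of a homomorphism that is a topological embedding. -/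
noncomputable def MonoidHom.continuousMulEquivRange {G H : Type*} [Group G] [Group H]
    [TopologicalSpace G] [TopologicalSpace H] (f : G →* H) (hf : IsEmbedding f) :
    G ≃ₜ* f.range where
  toMulEquiv := MonoidHom.ofInjective hf.injective
  continuous_toFun := hf.continuous.subtype_mk _
  continuous_invFun := by
    refine hf.continuous_iff.2 ?_
    convert continuous_subtype_val (p := fun h => h ∈ f.range)
    ext x
    exact congrArg Subtype.val ((MonoidHom.ofInjective hf.injective).apply_symm_apply x)

theorem MonoidHom.isEmbedding_restrict_range {G H L : Type*} [Group G] [Group H] [Group L]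
    [TopologicalSpace G] [TopologicalSpace H] [TopologicalSpace L] (f : G →* H) (k : H →* L)
    (hf : IsEmbedding f) (hkf : IsEmbedding (k.comp f)) :
    IsEmbedding fun h : f.range => k h := by
  let e := f.continuousMulEquivRange hf
  have h : (fun h : f.range => k h) = k.comp f ∘ e.symm.toHomeomorph := by
    refine funext fun x => ?_
    exact congrArg (fun x : f.range => k x) (e.apply_symm_apply x).symm
  rw [h]
  exact hkf.comp e.symm.toHomeomorph.isEmbedding

/-- For a (Hausdorff) topological group `G` of weight `𝔠`, its `Gδ`-modification is topologically
isomorphic to a subgroup of the homeomorphism group of some Parovičenko space `X`; moreover `X` can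
be taken to be `(ω × K)*` for a compact zero-dimensional `K`, with `G_(δ)` sitting inside the
homeomorphism group of `K` and being embedded by `f ↦ β(id × f) ↾ (ω × K)*`. -/
theorem theorem1p1 (G : Type u) [Group G] [TopologicalSpace G] [IsTopologicalGroup G] [T2Space G]
    (hG : topWeight G = 𝔠) :
    (∃ (X : Type u) (_ : TopologicalSpace X), IsParovicenko X ∧
      ∃ S : Subgroup (X ≃ₜ X), Nonempty (GDeltaMod G ≃ₜ* S)) ∧
    (∃ (K : Type u) (_ : TopologicalSpace K), CompactSpace K ∧ T2Space K ∧ IsZeroDimensional K ∧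
      IsParovicenko (CechStoneRemainder (ℕ × K)) ∧
      ∃ H : Subgroup (K ≃ₜ K), Nonempty (GDeltaMod G ≃ₜ* H) ∧
        IsEmbedding (fun f : H => omegaRemainderHom K f)) := by
  obtain ⟨D, _, hD, hDδ, hDG⟩ := exists_mulAction_isGδ G hG
  let _ : TopologicalSpace D := ⊥
  have : DiscreteTopology D := ⟨rfl⟩
  have hK : IsZeroDimensional (OnePoint D) := isZeroDimensional_onePoint
  have := hK.totallyDisconnectedSpace
  have hX : IsParovicenko (CechStoneRemainder (ℕ × OnePoint D)) :=
    isParovicenko_remainder (OnePoint.mk_isClopen_le aleph0_le_continuum hD)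
  let φ : GDeltaMod G →* (OnePoint D ≃ₜ OnePoint D) :=
    (onePointHom G D).comp (GDeltaMod.equiv G).toMonoidHom
  have hφ : IsInducing φ := isInducing_onePointHom hDδ hDG
  let ψ : GDeltaMod G →* _ := (omegaRemainderHom (OnePoint D)).comp φ
  have hψ : IsInducing ψ :=
    isInducing_omegaRemainderHom_comp (fun _ _ => iInter_mem_nhds_gDeltaMod) hφ
  -- Injectivity of `φ` and `ψ` comes from the separation of `GDeltaMod G`: an inducing map on a T₀
  -- space is an embedding.
  refine ⟨⟨CechStoneRemainder (ℕ × OnePoint D), inferInstance, hX, ψ.range,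
      ⟨ψ.continuousMulEquivRange hψ.isEmbedding⟩⟩,
    OnePoint D, inferInstance, inferInstance, inferInstance, hK, hX, φ.range,
    ⟨φ.continuousMulEquivRange hφ.isEmbedding⟩, ?_⟩
  exact MonoidHom.isEmbedding_restrict_range φ (omegaRemainderHom (OnePoint D)) hφ.isEmbedding
    hψ.isEmbedding
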